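/- Let $0<\theta_1\le\theta_2\le\cdots$ be a non-decreasing sequence of positive real numbers, and let $\mathbb N$ denote the set of positive integers. For each $n$, the Luce model on the symmetric group $S_n$ with weights $\theta_1,\dots,\theta_n$ is the probability distribution $$\pi_n(\tau)=\prod_{i=1}^n \frac{\theta_{\tau(i)}}{w_n-\sum_{j<i}\theta_{\tau(j)}},\qquad w_n=\theta_1+\cdots+\theta_n,\quad \tau\in S_n .$$ Let $\sigma_n$ be the reverse of a random permutation $\tau_n$ drawn from $\pi_n$, that is, $\sigma_n(i)=\tau_n(n+1-i)$ for $1\le i\le n$, extended to a random element of $\mathbb N^{\mathbb N}$ by $\sigma_n(i)=i$ for $i>n$; here $\mathbb N^{\mathbb N}$ carries the topology of pointwise convergence. For $x\ge 0$ let $$f(x)=\sum_{i=1}^\infty e^{-\theta_i x}\in[0,\infty],\qquad x_0=\inf\{x\ge 0: f(x)<\infty\},$$ with $\inf\emptyset=\infty$. Then $\sigma_n$ converges in law on $\mathbb N^{\mathbb N}$ as $n\to\infty$ if and only if $x_0<\infty$ and $f(x_0)=\infty$. Moreover, if this condition holds, then the limiting finite-dimensional probability mass functions are given as follows: for every $k\ge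 1$ and all distinct positive integers $a_1,\dots,a_k$, $$\lim_{n\to\infty}P(\sigma_n(1)=a_1,\dots,\sigma_n(k)=a_k)=\int_{x_1>x_2>\cdots>x_k>0}\ \prod_{j=1}^k\theta_{a_j}e^{-\theta_{a_j}x_j}\prod_{i\notin\{a_1,\dots,a_k\}}\bigl(1-e^{-\theta_i x_k}\bigr)\,dx_1\cdots dx_k ,$$ where the integrand is integrable, and this number is also the probability that the limit law gives to the event that the first $k$ values are $a_1,\dots,a_k$. -/

import Mathlib

open MeasureTheory Filter Topology
open scoped ENNReal NNReal

/-! Positive integers are relabelled by `ℕ` (the positive integer `i` is written `i - 1`), for the balls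
as well as for the positions in a permutation. -/

noncomputable section

/-- The Luce probability of `σ`, where `σ i` is the `i`-th ball drawn: the product over `i` of
`θ (σ i)` divided by the total weight minus the weights of the balls drawn before step `i`. -/
def luceWeight {n : ℕ} (θ : Fin n → ℝ) (σ : Equiv.Perm (Fin n)) : ℝ :=
  ∏ i, θ (σ i) / ((∑ j, θ j) - ∑ j ∈ Finset.Iio i, θ (σ j))

theorem luceWeight_nonneg {n : ℕ} (θ : Fin n → ℝ) (hθ : ∀ i, 0 < θ i)
    (σ : Equiv.Perm (Fin n)) : 0 ≤ luceWeight θ σ := by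
  refine Finset.prod_nonneg fun i _ => div_nonneg (hθ _).le ?_
  rw [← Equiv.sum_comp σ θ, sub_nonneg]
  exact Finset.sum_le_sum_of_subset_of_nonneg (Finset.subset_univ _) fun j _ _ => (hθ _).le

theorem luceWeight_decomposeFin {n : ℕ} (θ : Fin (n + 1) → ℝ) (p : Fin (n + 1))
    (e : Equiv.Perm (Fin n)) :
    luceWeight θ (Equiv.Perm.decomposeFin.symm (p, e)) =
      θ p / (∑ j, θ j) * luceWeight (fun i => θ (Equiv.swap 0 p i.succ)) e := by
  have hs : ∑ j, θ j = θ p + ∑ i : Fin n, θ (Equiv.swap 0 p i.succ) := by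
    rw [← Equiv.sum_comp (Equiv.swap 0 p) θ, Fin.sum_univ_succ]
    simp
  unfold luceWeight
  rw [Fin.prod_univ_succ]
  congr 1
  · have : Finset.Iio (0 : Fin (n + 1)) = ∅ := by ext x; simp
    simp [this]
  · refine Finset.prod_congr rfl fun i _ => ?_
    have hI : ∑ j ∈ Finset.Iio i.succ, θ (Equiv.Perm.decomposeFin.symm (p, e) j) =
        θ p + ∑ j ∈ Finset.Iio i, θ (Equiv.swap 0 p (e j).succ) := by
      have h1 : Finset.Iio i.succ =
          insert 0 ((Finset.Iio i).map (Fin.succEmb n)) := by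
        ext x
        refine Fin.cases ?_ (fun y => ?_) x
        · simp
        · simp
      rw [h1, Finset.sum_insert (by simp), Finset.sum_map]
      simp
    rw [hI, hs]
    simp

theorem sum_luceWeight : ∀ {n : ℕ} (θ : Fin n → ℝ), (∀ i, 0 < θ i) →
    ∑ σ, luceWeight θ σ = 1
  | 0, θ, _ => by simp [luceWeight]
  | n + 1, θ, hθ => by
    rw [← Equiv.sum_comp Equiv.Perm.decomposeFin.symm, Fintype.sum_prod_type]
    simp only [luceWeight_decomposeFin, ← Finset.mul_sum]
    have h : ∀ p : Fin (n + 1),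
        ∑ e, luceWeight (fun i : Fin n => θ (Equiv.swap 0 p i.succ)) e = 1 :=
      fun p => sum_luceWeight _ fun i => hθ _
    simp only [h, mul_one, ← Finset.sum_div]
    exact div_self (Finset.sum_pos (fun i _ => hθ i) Finset.univ_nonempty).ne'

/-- The Luce model on `S_n`. -/
def lucePMF {n : ℕ} (θ : Fin n → ℝ) (hθ : ∀ i, 0 < θ i) : PMF (Equiv.Perm (Fin n)) :=
  PMF.ofFintype (fun σ => ENNReal.ofReal (luceWeight θ σ)) (by
    rw [← ENNReal.ofReal_sum_of_nonneg fun σ _ => luceWeight_nonneg θ hθ σ, sum_luceWeight θ hθ,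
      ENNReal.ofReal_one])

/-- The reverse of a permutation: its first value is the last value of `σ`, and so on. -/
def reversePerm {n : ℕ} (σ : Equiv.Perm (Fin n)) : Equiv.Perm (Fin n) :=
  Fin.revPerm.trans σ

/-- A permutation of the first `n` labels, extended to all labels by the identity. -/
def extendPerm {n : ℕ} (σ : Equiv.Perm (Fin n)) : ℕ → ℕ :=
  fun i => if h : i < n then (σ ⟨i, h⟩ : ℕ) else i

/-- The law, on the space of all maps `ℕ → ℕ` with the topology of pointwise convergence, of
the (extended) reverse of a Luce random permutation with weights `θ 0, …, θ (n - 1)`. -/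
def reverseLuceLaw (θ : ℕ → ℝ) (hθ : ∀ i, 0 < θ i) (n : ℕ) : ProbabilityMeasure (ℕ → ℕ) :=
  ⟨((lucePMF (fun i : Fin n => θ i) fun i => hθ i).map
    fun σ => extendPerm (reversePerm σ)).toMeasure, inferInstance⟩

/-- `f(x) = ∑ exp (-θ_i x)`, possibly infinite. -/
def expSum (θ : ℕ → ℝ) (x : ℝ≥0) : ℝ≥0∞ :=
  ∑' i, ENNReal.ofReal (Real.exp (-θ i * x))

/-- `x₀ = inf {x ≥ 0 : f(x) < ∞}`, with `inf ∅ = ∞`. -/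
def critPoint (θ : ℕ → ℝ) : ℝ≥0∞ :=
  sInf ((fun x : ℝ≥0 => (x : ℝ≥0∞)) '' {x | expSum θ x < ∞})

/-- The region `x_0 > x_1 > ⋯ > x_k > 0`. -/
def decreasingRegion (k : ℕ) : Set (Fin (k + 1) → ℝ) :=
  {x | StrictAnti x ∧ 0 < x (Fin.last k)}

/-- The integrand of the limiting mass function at `(a_0, …, a_k)`. On `decreasingRegion k` all
factors of the infinite product lie in `[0, 1]`, so that it converges unconditionally
(possibly to `0`). -/
def limitIntegrand (θ : ℕ → ℝ) {k : ℕ} (a : Fin (k + 1) → ℕ) (x : Fin (k + 1) → ℝ) : ℝ :=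
  (∏ j, θ (a j) * Real.exp (-θ (a j) * x j)) *
    ∏' i : {i : ℕ // i ∉ Set.range a}, (1 - Real.exp (-θ i * x (Fin.last k)))

/-- The maps whose first values are `a_0, …, a_k`. -/
def cylinderAt {k : ℕ} (a : Fin (k + 1) → ℕ) : Set (ℕ → ℕ) :=
  {s | ∀ j : Fin (k + 1), s j = a j}

end

open ProbabilityTheory

noncomputable section

/-! Exponential embedding: let `X_i` be independent exponential variables with rates `θ i`. By
memorylessness, listing `X_1, …, X_n` in increasing order draws the indices according to the Luce
model (`expProduct_sort_eq`). Hence `σ_n` has the law of the indices sorted by decreasing value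
(`reverseLuceLaw_eq_map`), and all `σ_n` live on one probability space.

Since `f(x) = ∑ P(X_i > x)`, the Borel–Cantelli lemmas govern the top of the sample. If `f(x₀) = ∞`,
almost surely infinitely many `X_i` exceed `x₀` but only finitely many exceed any `y > x₀`. So there
is a largest value, a second largest, and so on, and every entry of `σ_n` is eventually constant
(`exists_tendsto_sortedIndices`); almost sure convergence gives convergence in law.

Otherwise, with positive probability the supremum is not attained: either `x₀ = ∞` and the sample is
unbounded, or `f(x₀) < ∞` and all `X_i` stay below `x₀` while accumulating there
(`expProduct_forall_le_ne_zero`). On that event `σ_n(1) → ∞`, so mass escapes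
(`not_tendsto_reverseLuceLaw`).

For the mass functions, `σ_n` starts with `a` exactly on `topEvent a n`. These events decrease in
`n`, and the probability of their intersection is found by fixing the values at `a` and using
independence of the rest (`expProduct_iInter_topEvent`). -/

/-! ### Exponential laws on the line. -/

theorem expMeasure_eq_withDensity (r : ℝ) :
    expMeasure r = volume.withDensity (exponentialPDF r) := rfl

theorem measurable_exponentialPDF (r : ℝ) : Measurable (exponentialPDF r) :=
  (measurable_exponentialPDFReal r).ennreal_ofReal

instance (r : ℝ) : NullSingletonClass (expMeasure r) := by
  rw [expMeasure_eq_withDensity]; infer_instance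

theorem expMeasure_Iic {r : ℝ} (hr : 0 < r) {x : ℝ} (hx : 0 ≤ x) :
    expMeasure r (Set.Iic x) = ENNReal.ofReal (1 - Real.exp (-r * x)) := by
  rw [expMeasure_eq_withDensity, withDensity_apply _ measurableSet_Iic,
    lintegral_exponentialPDF_eq_antiDeriv hr, if_pos hx, neg_mul]

theorem expMeasure_Iio {r : ℝ} (hr : 0 < r) {x : ℝ} (hx : 0 ≤ x) :
    expMeasure r (Set.Iio x) = ENNReal.ofReal (1 - Real.exp (-r * x)) := by
  rw [measure_congr Iio_ae_eq_Iic, expMeasure_Iic hr hx]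

theorem expMeasure_Ioi {r : ℝ} (hr : 0 < r) {x : ℝ} (hx : 0 ≤ x) :
    expMeasure r (Set.Ioi x) = ENNReal.ofReal (Real.exp (-r * x)) := by
  have := isProbabilityMeasure_expMeasure hr
  have h1 : Real.exp (-r * x) ≤ 1 := Real.exp_le_one_iff.2 (by nlinarith)
  rw [← Set.compl_Iic, prob_compl_eq_one_sub measurableSet_Iic, expMeasure_Iic hr hx,
    ← ENNReal.ofReal_one, ← ENNReal.ofReal_sub _ (by linarith)]
  simp

theorem expMeasure_ae_pos {r : ℝ} (hr : 0 < r) : ∀ᵐ x ∂expMeasure r, 0 < x := by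
  rw [ae_iff]
  have : {x : ℝ | ¬ 0 < x} = Set.Iic 0 := by ext; simp
  rw [this, expMeasure_Iic hr le_rfl]
  simp

/-- Tilting the rate-`r` density by `exp (-x * s)` gives `r / (r + s)` times the rate-`r + s`
density. This is one draw: `exp (-x * s)` is the chance that competitors of total rate `s` all
exceed `x`. -/
theorem setLIntegral_exp_expMeasure {r s t : ℝ} (hr : 0 < r) (hs : 0 ≤ s) (ht : 0 ≤ t) :
    ∫⁻ x in Set.Ioi t, ENNReal.ofReal (Real.exp (-x * s)) ∂expMeasure r =
      ENNReal.ofReal (Real.exp (-t * (r + s)) * (r / (r + s))) := by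
  have hrs : 0 < r + s := by linarith
  rw [expMeasure_eq_withDensity, setLIntegral_withDensity_eq_setLIntegral_mul _
    (measurable_exponentialPDF r) (by fun_prop) measurableSet_Ioi]
  have h : ∀ x ∈ Set.Ioi t, (exponentialPDF r * fun x => ENNReal.ofReal (Real.exp (-x * s))) x =
      ENNReal.ofReal (r / (r + s)) * exponentialPDF (r + s) x := by
    intro x hx
    have hx0 : 0 ≤ x := ht.trans (le_of_lt hx)
    rw [Pi.mul_apply, exponentialPDF_of_nonneg hx0, exponentialPDF_of_nonneg hx0,
      ← ENNReal.ofReal_mul (by positivity), ← ENNReal.ofReal_mul (by positivity), mul_assoc,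
      ← Real.exp_add]
    congr 1
    rw [← mul_assoc, div_mul_cancel₀ _ hrs.ne']
    congr 2
    ring
  rw [setLIntegral_congr_fun measurableSet_Ioi h,
    lintegral_const_mul _ (measurable_exponentialPDF _), ← withDensity_apply _ measurableSet_Ioi,
    ← expMeasure_eq_withDensity, expMeasure_Ioi hrs ht, ← ENNReal.ofReal_mul (by positivity)]
  congr 1
  rw [mul_comm]
  congr 2
  ring

/-! ### Luce weights as probabilities of orderings. -/

theorem luceWeight_eq_one {n : ℕ} (θ : Fin n → ℝ) (τ : Equiv.Perm (Fin n)) :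
    luceWeight θ τ = luceWeight (θ ∘ τ) 1 := by
  unfold luceWeight
  simp only [Equiv.Perm.coe_one, id_eq, Function.comp_apply]
  rw [Equiv.sum_comp τ θ]

theorem luceWeight_one_succ {n : ℕ} (c : Fin (n + 1) → ℝ) :
    luceWeight c 1 = c 0 / (∑ j, c j) * luceWeight (fun i => c i.succ) 1 := by
  have h := luceWeight_decomposeFin c 0 1
  have h1 : Equiv.Perm.decomposeFin.symm ((0 : Fin (n + 1)), (1 : Equiv.Perm (Fin n))) = 1 := by
    simp [Equiv.Perm.one_def]
  rw [h1] at h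
  simpa using h

theorem measurableSet_strictMono_lt {n : ℕ} (t : ℝ) :
    MeasurableSet {x : Fin n → ℝ | StrictMono x ∧ ∀ i, t < x i} := by
  have : {x : Fin n → ℝ | StrictMono x ∧ ∀ i, t < x i} =
      (⋂ i, ⋂ j, ⋂ (_ : i < j), {x : Fin n → ℝ | x i < x j}) ∩ ⋂ i, {x : Fin n → ℝ | t < x i} := by
    ext x; simp [StrictMono]
  rw [this]
  refine .inter (.iInter fun i => .iInter fun j => .iInter fun _ => ?_) (.iInter fun i => ?_)
  · exact measurableSet_lt (by fun_prop) (by fun_prop)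
  · exact measurableSet_lt (by fun_prop) (by fun_prop)

theorem strictMono_cons_and_lt_iff {n : ℕ} (t x : ℝ) (y : Fin n → ℝ) :
    (StrictMono (Fin.cons x y : Fin (n + 1) → ℝ) ∧
      ∀ i, t < (Fin.cons x y : Fin (n + 1) → ℝ) i) ↔ t < x ∧ StrictMono y ∧ ∀ i, x < y i := by
  constructor
  · rintro ⟨h1, h2⟩
    refine ⟨by simpa using h2 0, fun i j hij => ?_, fun i => ?_⟩
    · simpa using h1 (Fin.succ_lt_succ_iff.2 hij)
    · simpa using h1 (Fin.succ_pos i)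
  · rintro ⟨h1, h2, h3⟩
    refine ⟨fun i j hij => ?_, fun i => ?_⟩
    · induction i using Fin.cases with
      | zero =>
        induction j using Fin.cases with
        | zero => exact absurd hij (lt_irrefl _)
        | succ j => simpa using h3 j
      | succ i =>
        induction j using Fin.cases with
        | zero => exact absurd hij (by simp)
        | succ j => simpa using h2 (Fin.succ_lt_succ_iff.1 hij)
    · induction i using Fin.cases with
      | zero => simpa using h1
      | succ i => simpa using h1.trans (h3 i)

/-- The threshold `t` makes the induction close: given the first coordinate `x > t`, the remaining
ones must satisfy the same event with threshold `x`. The exponential factor is the probability that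
all coordinates exceed `t`. -/
theorem pi_expMeasure_strictMono : ∀ {n : ℕ} (c : Fin n → ℝ), (∀ i, 0 < c i) → ∀ t : ℝ, 0 ≤ t →
    Measure.pi (fun i => expMeasure (c i)) {x | StrictMono x ∧ ∀ i, t < x i} =
      ENNReal.ofReal (Real.exp (-t * ∑ i, c i) * luceWeight c 1)
  | 0, c, hc, t, ht => by
    have : {x : Fin 0 → ℝ | StrictMono x ∧ ∀ i, t < x i} = Set.univ := by
      ext x; simp [StrictMono]
    rw [this]
    simp [luceWeight]
  | n + 1, c, hc, t, ht => by
    have hp := fun i => isProbabilityMeasure_expMeasure (hc i)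
    have hmp := (measurePreserving_piFinSuccAbove (fun i => expMeasure (c i)) 0).symm
    rw [← hmp.map_eq, Measure.map_apply hmp.measurable (measurableSet_strictMono_lt t),
      Measure.prod_apply (hmp.measurable (measurableSet_strictMono_lt t))]
    have hS : ∀ x : ℝ, (Measure.pi fun j : Fin n => expMeasure (c (Fin.succAbove 0 j)))
        (Prod.mk x ⁻¹' (⇑(MeasurableEquiv.piFinSuccAbove (fun _ : Fin (n + 1) => ℝ) 0).symm ⁻¹'
          {x | StrictMono x ∧ ∀ i, t < x i})) =
        (Set.Ioi t).indicator (fun x => ENNReal.ofReal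
          (Real.exp (-x * ∑ i : Fin n, c i.succ) * luceWeight (fun i => c i.succ) 1)) x := by
      intro x
      have hset : (Prod.mk x ⁻¹' (⇑(MeasurableEquiv.piFinSuccAbove
          (fun _ : Fin (n + 1) => ℝ) 0).symm ⁻¹' {x | StrictMono x ∧ ∀ i, t < x i})) =
          {y : Fin n → ℝ | t < x ∧ StrictMono y ∧ ∀ i, x < y i} := by
        ext y
        simp only [Set.mem_preimage, Set.mem_ofPred_eq]
        rw [← strictMono_cons_and_lt_iff]
        simp [MeasurableEquiv.piFinSuccAbove, Fin.insertNthEquiv]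
      rw [hset]
      by_cases hx : t < x
      · rw [Set.indicator_of_mem (show x ∈ Set.Ioi t from hx),
          ← pi_expMeasure_strictMono (fun i => c i.succ) (fun i => hc _) x (ht.trans hx.le)]
        simp [hx]
      · rw [Set.indicator_of_notMem (show x ∉ Set.Ioi t from hx)]
        simp [hx]
    simp_rw [hS]
    rw [lintegral_indicator measurableSet_Ioi]
    simp_rw [ENNReal.ofReal_mul (Real.exp_nonneg _)]
    rw [lintegral_mul_const _ (by fun_prop),
      setLIntegral_exp_expMeasure (hc 0) (Finset.sum_nonneg fun i _ => (hc _).le) ht,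
      ← ENNReal.ofReal_mul (Real.exp_nonneg _), ← ENNReal.ofReal_mul (mul_nonneg (Real.exp_nonneg _)
        (div_nonneg (hc _).le (add_nonneg (hc _).le (Finset.sum_nonneg fun i _ => (hc _).le)))),
      luceWeight_one_succ, Fin.sum_univ_succ, mul_assoc]

/-! ### The infinite exponential sample and its sorted indices. -/

/-- The law of a sequence of independent exponential variables with rates `θ i`. -/
def expProduct (θ : ℕ → ℝ) : Measure (ℕ → ℝ) :=
  Measure.infinitePi fun i => expMeasure (θ i)

/-- The indices `0, …, n - 1`, sorted by decreasing value of `ω`; larger indices stay in place. -/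
def sortedIndices (n : ℕ) (ω : ℕ → ℝ) : ℕ → ℕ :=
  extendPerm (reversePerm (Tuple.sort fun i : Fin n => ω i))

theorem isProbabilityMeasure_expProduct {θ : ℕ → ℝ} (hθ : ∀ i, 0 < θ i) :
    IsProbabilityMeasure (expProduct θ) := by
  have := fun i => isProbabilityMeasure_expMeasure (hθ i)
  unfold expProduct
  infer_instance

theorem measurePreserving_eval_expProduct {θ : ℕ → ℝ} (hθ : ∀ i, 0 < θ i) (i : ℕ) :
    MeasurePreserving (fun ω : ℕ → ℝ => ω i) (expProduct θ) (expMeasure (θ i)) := by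
  have := fun i => isProbabilityMeasure_expMeasure (hθ i)
  exact measurePreserving_eval_infinitePi _ i

theorem expProduct_map_comp {θ : ℕ → ℝ} (hθ : ∀ i, 0 < θ i) {n : ℕ} {f : Fin n → ℕ}
    (hf : Function.Injective f) :
    (expProduct θ).map (fun ω i => ω (f i)) = Measure.pi fun i => expMeasure (θ (f i)) := by
  have := fun i => isProbabilityMeasure_expMeasure (hθ i)
  rw [expProduct, Measure.map_infinitePi_infinitePi_of_inj hf, Measure.infinitePi_eq_pi]

theorem expProduct_ae_pos {θ : ℕ → ℝ} (hθ : ∀ i, 0 < θ i) :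
    ∀ᵐ ω ∂expProduct θ, ∀ i, 0 < ω i :=
  ae_all_iff.2 fun i =>
    (measurePreserving_eval_expProduct hθ i).quasiMeasurePreserving.ae (expMeasure_ae_pos (hθ i))

theorem expProduct_ae_ne {θ : ℕ → ℝ} (hθ : ∀ i, 0 < θ i) (c : ℝ) :
    ∀ᵐ ω ∂expProduct θ, ∀ i, ω i ≠ c :=
  ae_all_iff.2 fun i => (measurePreserving_eval_expProduct hθ i).quasiMeasurePreserving.ae
    (measure_eq_zero_iff_ae_notMem.1 (measure_singleton c))

theorem expProduct_ae_injective {θ : ℕ → ℝ} (hθ : ∀ i, 0 < θ i) :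
    ∀ᵐ ω ∂expProduct θ, Function.Injective ω := by
  have hp := fun i => isProbabilityMeasure_expMeasure (hθ i)
  have h : ∀ i j : ℕ, ∀ᵐ ω ∂expProduct θ, ω i = ω j → i = j := by
    intro i j
    by_cases hij : i = j
    · exact .of_forall fun _ _ => hij
    · have hd : ∀ᵐ p ∂(expMeasure (θ i)).prod (expMeasure (θ j)), p.1 ≠ p.2 := by
        rw [Measure.ae_prod_iff_ae_ae (p := fun p : ℝ × ℝ => p.1 ≠ p.2)
          (measurableSet_eq_fun measurable_fst measurable_snd).compl]
        refine .of_forall fun x => ?_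
        filter_upwards [measure_eq_zero_iff_ae_notMem.1 (measure_singleton (μ := expMeasure (θ j)) x)]
          with y hy h
        exact hy h.symm
      rw [← Measure.infinitePi_map_eval_prod (P := fun i => expMeasure (θ i)) hij] at hd
      filter_upwards [ae_of_ae_map (by fun_prop) hd] with ω hω h
      exact absurd h hω
  filter_upwards [ae_all_iff.2 fun i => ae_all_iff.2 (h i)] with ω hω i j hij
  exact hω i j hij

instance permMeasurableSpace {n : ℕ} : MeasurableSpace (Equiv.Perm (Fin n)) := ⊤

instance {n : ℕ} : MeasurableSingletonClass (Equiv.Perm (Fin n)) := ⟨fun _ => trivial⟩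

theorem measurable_tupleSort {n : ℕ} : Measurable (fun x : Fin n → ℝ => Tuple.sort x) := by
  refine measurable_to_countable' fun τ => ?_
  have : (fun x : Fin n → ℝ => Tuple.sort x) ⁻¹' {τ} =
      {x | (∀ i j, i ≤ j → x (τ i) ≤ x (τ j)) ∧
        ∀ i j, i < j → x (τ i) = x (τ j) → τ i < τ j} := by
    ext x
    simp only [Set.mem_preimage, Set.mem_singleton_iff, Set.mem_ofPred_eq]
    rw [eq_comm, Tuple.eq_sort_iff]
    rfl
  rw [this]
  measurability

theorem measurable_sortedIndices (n : ℕ) : Measurable (sortedIndices n) :=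
  (measurable_from_top (f := fun τ : Equiv.Perm (Fin n) => extendPerm (reversePerm τ))).comp
    (measurable_tupleSort.comp (by fun_prop : Measurable fun (ω : ℕ → ℝ) (i : Fin n) => ω i))

theorem sort_eq_iff_strictMono {n : ℕ} {x : Fin n → ℝ} (hx : Function.Injective x)
    (τ : Equiv.Perm (Fin n)) : Tuple.sort x = τ ↔ StrictMono (x ∘ τ) := by
  rw [eq_comm, Tuple.eq_sort_iff]
  constructor
  · rintro ⟨h, -⟩
    exact h.strictMono_of_injective (hx.comp τ.injective)
  · intro h
    exact ⟨h.monotone, fun i j hij he => absurd he (h hij).ne⟩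

theorem expProduct_sort_eq {θ : ℕ → ℝ} (hθ : ∀ i, 0 < θ i) {n : ℕ} (τ : Equiv.Perm (Fin n)) :
    expProduct θ {ω | Tuple.sort (fun i : Fin n => ω i) = τ} =
      ENNReal.ofReal (luceWeight (fun i : Fin n => θ i) τ) := by
  have h : {ω : ℕ → ℝ | Tuple.sort (fun i : Fin n => ω i) = τ} =ᵐ[expProduct θ]
      (fun (ω : ℕ → ℝ) (i : Fin n) => ω (τ i : ℕ)) ⁻¹' {x | StrictMono x ∧ ∀ i, 0 < x i} := by
    rw [eventuallyEq_set]
    filter_upwards [expProduct_ae_injective hθ, expProduct_ae_pos hθ] with ω h1 h2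
    have := sort_eq_iff_strictMono (h1.comp Fin.val_injective : Function.Injective
      fun i : Fin n => ω i) τ
    simp only [Set.mem_ofPred_eq, Set.mem_preimage, h2, implies_true, and_true]
    exact this
  rw [measure_congr h, ← Measure.map_apply (by fun_prop) (measurableSet_strictMono_lt 0),
    expProduct_map_comp hθ (f := fun i => (τ i : ℕ)) (Fin.val_injective.comp τ.injective),
    pi_expMeasure_strictMono _ (fun i => hθ _) 0 le_rfl,
    luceWeight_eq_one (fun i : Fin n => θ i) τ]
  simp [Function.comp_def]

/-- Sorting independent exponential variables yields the Luce model. -/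
theorem reverseLuceLaw_eq_map {θ : ℕ → ℝ} (hθ : ∀ i, 0 < θ i) (n : ℕ) :
    (reverseLuceLaw θ hθ n : Measure (ℕ → ℕ)) = (expProduct θ).map (sortedIndices n) := by
  have hr : Measurable fun (ω : ℕ → ℝ) (i : Fin n) => ω i := by fun_prop
  have hs : Measurable fun ω : ℕ → ℝ => Tuple.sort fun i : Fin n => ω i :=
    measurable_tupleSort.comp hr
  have hg : Measurable fun τ : Equiv.Perm (Fin n) => extendPerm (reversePerm τ) :=
    measurable_from_top
  have h1 : (lucePMF (fun i : Fin n => θ i) fun i => hθ i).toMeasure =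
      (expProduct θ).map fun ω => Tuple.sort fun i : Fin n => ω i := by
    refine Measure.ext_of_singleton fun τ => ?_
    rw [PMF.toMeasure_apply_singleton _ _ (measurableSet_singleton τ),
      Measure.map_apply hs (measurableSet_singleton τ)]
    exact (expProduct_sort_eq hθ τ).symm
  change ((lucePMF (fun i : Fin n => θ i) fun i => hθ i).map
    fun σ => extendPerm (reversePerm σ)).toMeasure = _
  rw [← PMF.toMeasure_map (hf := hg), h1, Measure.map_map hg hs]
  rfl

/-! ### Combinatorics of sorting a fixed sequence. -/

theorem sortedIndices_of_lt {n i : ℕ} (ω : ℕ → ℝ) (h : i < n) :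
    sortedIndices n ω i = (Tuple.sort (fun i : Fin n => ω i) (Fin.rev ⟨i, h⟩) : Fin n) := by
  simp [sortedIndices, extendPerm, reversePerm, h]

theorem sortedIndices_lt {n i : ℕ} (ω : ℕ → ℝ) (h : i < n) : sortedIndices n ω i < n := by
  rw [sortedIndices_of_lt ω h]
  exact Fin.is_lt _

theorem exists_sortedIndices_eq {n i : ℕ} (ω : ℕ → ℝ) (h : i < n) :
    ∃ m < n, sortedIndices n ω m = i := by
  set τ := Tuple.sort fun i : Fin n => ω i with hτ
  refine ⟨Fin.rev (τ.symm ⟨i, h⟩), Fin.is_lt _, ?_⟩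
  rw [sortedIndices_of_lt ω (Fin.is_lt _), ← hτ, Fin.eta, Fin.rev_rev, Equiv.apply_symm_apply]

theorem apply_sortedIndices_lt {n i j : ℕ} {ω : ℕ → ℝ} (hω : Function.Injective ω) (hij : i < j)
    (hj : j < n) : ω (sortedIndices n ω j) < ω (sortedIndices n ω i) := by
  have hmono : StrictMono _ := (Tuple.monotone_sort fun i : Fin n => ω i).strictMono_of_injective
    ((hω.comp Fin.val_injective).comp (Equiv.injective _))
  rw [sortedIndices_of_lt ω hj, sortedIndices_of_lt ω (hij.trans hj)]
  exact hmono (Fin.rev_lt_rev.2 hij)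

theorem apply_sortedIndices_zero_ge {n i : ℕ} {ω : ℕ → ℝ} (hω : Function.Injective ω)
    (hi : i < n) : ω i ≤ ω (sortedIndices n ω 0) := by
  obtain ⟨m, hm, rfl⟩ := exists_sortedIndices_eq ω hi
  rcases Nat.eq_zero_or_pos m with rfl | h0
  · exact le_rfl
  · exact (apply_sortedIndices_lt hω h0 hm).le

/-- The sequences whose `k + 1` largest values among the first `n` are, in decreasing order, those at
`a 0, …, a k`. -/
def topEvent {k : ℕ} (a : Fin (k + 1) → ℕ) (n : ℕ) : Set (ℕ → ℝ) :=
  {ω | StrictAnti (ω ∘ a) ∧ ∀ i < n, i ∉ Set.range a → ω i < ω (a (Fin.last k))}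

theorem sortedIndices_mem_cylinderAt_iff {n k : ℕ} {ω : ℕ → ℝ} (hω : Function.Injective ω)
    {a : Fin (k + 1) → ℕ} (ha : Function.Injective a) (hn : ∀ j, a j < n) :
    sortedIndices n ω ∈ cylinderAt a ↔ ω ∈ topEvent a n := by
  have hkn : k < n := by
    have := Fintype.card_le_of_injective (fun j => (⟨a j, hn j⟩ : Fin n))
      fun i j h => ha (by simpa using h)
    simpa using this
  have hjn : ∀ j : Fin (k + 1), (j : ℕ) < n := fun j => (Nat.le_of_lt_succ j.2).trans_lt hkn
  constructor
  · intro h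
    refine ⟨fun i j hij => ?_, fun i hi hia => ?_⟩
    · simp only [Function.comp_apply]
      rw [← h i, ← h j]
      exact apply_sortedIndices_lt hω hij (hjn j)
    · obtain ⟨m, hm, rfl⟩ := exists_sortedIndices_eq ω hi
      have hkm : k < m := by
        by_contra hc
        exact hia ⟨⟨m, by omega⟩, (h _).symm⟩
      rw [← h (Fin.last k)]
      exact apply_sortedIndices_lt hω hkm hm
  · rintro ⟨hanti, hrest⟩
    -- Strong induction on the position: `a j` occurs at some position `m`. If `m < j`, that place
    -- already belongs to another `a l`; if `m > j`, position `j` carries a value above `ω (a j)`,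
    -- which is possible neither for an earlier `a l` nor for an index outside the range.
    have key : ∀ m, ∀ j : Fin (k + 1), (j : ℕ) = m → sortedIndices n ω m = a j := by
      intro m
      induction m using Nat.strong_induction_on with
      | _ m ih =>
        rintro j rfl
        obtain ⟨m, hm, hma⟩ := exists_sortedIndices_eq ω (hn j)
        rcases lt_trichotomy m j with hlt | heq | hgt
        · have h1 := ih m hlt ⟨m, hlt.trans j.2⟩ rfl
          have h2 := congrArg Fin.val (ha (h1.symm.trans hma))
          simp only at h2
          omega
        · rw [← heq, hma]
        · exfalso
          have h1 := apply_sortedIndices_lt hω hgt hm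
          rw [hma] at h1
          by_cases hr : sortedIndices n ω j ∈ Set.range a
          · obtain ⟨l, hl⟩ := hr
            rw [← hl] at h1
            have hlj : l < j := hanti.lt_iff_gt.1 h1
            have h2 := ih l hlj l rfl
            have h3 := apply_sortedIndices_lt hω hlj (hjn j)
            rw [h2, hl] at h3
            exact lt_irrefl _ h3
          · have h2 := hrest _ (sortedIndices_lt ω (hjn j)) hr
            have h3 : ω (a (Fin.last k)) ≤ ω (a j) := hanti.antitone (Fin.le_last j)
            linarith
    exact fun j => key j j rfl

/-- Maxima are removed greedily. Outside a finite set some `ω i₀` exceeds `c`, and only finitely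
many indices reach the level `ω i₀`, so a maximum exists there. -/
theorem exists_decreasing_enumeration {ω : ℕ → ℝ} (hω : Function.Injective ω) {c : ℝ}
    (hinf : ∃ᶠ i in atTop, c < ω i) (hfin : ∀ y, c < y → ∀ᶠ i in atTop, ω i ≤ y) :
    ∃ b : ℕ → ℕ, StrictAnti (ω ∘ b) ∧ ∀ k i, (∀ m ≤ k, b m ≠ i) → ω i < ω (b k) := by
  have hmax : ∀ S : Finset ℕ, ∃ m, m ∉ S ∧ ∀ i ∉ S, ω i ≤ ω m := by
    intro S
    obtain ⟨i₀, hi₀, hc⟩ : ∃ i, i ∉ S ∧ c < ω i := by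
      obtain ⟨N, hN⟩ := S.bddAbove
      obtain ⟨i, hi, h⟩ := frequently_atTop.1 hinf (N + 1)
      exact ⟨i, fun hS => by have := hN hS; omega, h⟩
    obtain ⟨y, hy1, hy2⟩ := exists_between hc
    obtain ⟨N, hN⟩ := eventually_atTop.1 (hfin y hy1)
    have hf : {i | i ∉ S ∧ ω i₀ ≤ ω i}.Finite := (Set.finite_lt_nat N).subset fun i hi => by
      by_contra h
      have := hN i (not_lt.1 h)
      linarith [hi.2]
    obtain ⟨m, hm, hle⟩ := Set.exists_max_image _ ω hf ⟨i₀, hi₀, le_rfl⟩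
    refine ⟨m, hm.1, fun i hi => ?_⟩
    rcases le_total (ω i₀) (ω i) with h | h
    · exact hle i ⟨hi, h⟩
    · exact h.trans hm.2
  choose g hg1 hg2 using hmax
  -- `T n` collects the first `n` chosen indices.
  let T : ℕ → Finset ℕ := Nat.rec ∅ fun _ S => insert (g S) S
  have hT : ∀ n, T (n + 1) = insert (g (T n)) (T n) := fun n => rfl
  have hmem : ∀ n i, i ∈ T n → ∃ m < n, g (T m) = i := by
    intro n
    induction n with
    | zero => intro i hi; exact absurd hi (Finset.notMem_empty i)
    | succ n ih =>
      intro i hi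
      rw [hT, Finset.mem_insert] at hi
      rcases hi with rfl | hi
      · exact ⟨n, n.lt_succ_self, rfl⟩
      · obtain ⟨m, hm, h⟩ := ih i hi
        exact ⟨m, hm.trans n.lt_succ_self, h⟩
  have hlt : ∀ k i, i ∉ T (k + 1) → ω i < ω (g (T k)) := by
    intro k i hi
    rw [hT, Finset.mem_insert, not_or] at hi
    exact (hg2 _ i hi.2).lt_of_ne fun h => hi.1 (hω h)
  refine ⟨fun n => g (T n), strictAnti_nat_of_succ_lt fun n => hlt n _ (hg1 _), fun k i hi => ?_⟩
  refine hlt k i fun h => ?_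
  obtain ⟨m, hm, h⟩ := hmem (k + 1) i h
  exact hi m (Nat.le_of_lt_succ hm) h

theorem exists_tendsto_sortedIndices {ω : ℕ → ℝ} (hω : Function.Injective ω) {c : ℝ}
    (hinf : ∃ᶠ i in atTop, c < ω i) (hfin : ∀ y, c < y → ∀ᶠ i in atTop, ω i ≤ y) :
    ∃ s, Tendsto (fun n => sortedIndices n ω) atTop (𝓝 s) := by
  obtain ⟨b, hb, hrest⟩ := exists_decreasing_enumeration hω hinf hfin
  have hbi : Function.Injective b := fun i j h => hb.injective (congrArg ω h)
  refine ⟨b, tendsto_pi_nhds.2 fun k => tendsto_nhds_of_eventually_eq ?_⟩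
  let a : Fin (k + 1) → ℕ := fun j => b j
  have hN : ∀ᶠ n in atTop, ∀ j, a j < n :=
    eventually_all.2 fun j => eventually_gt_atTop (a j)
  filter_upwards [hN] with n hn
  refine (sortedIndices_mem_cylinderAt_iff hω (hbi.comp Fin.val_injective) hn).2
    ⟨fun i j hij => hb hij, fun i _ hi => hrest k i fun m hm h => hi ⟨⟨m, by omega⟩, h⟩⟩
    (Fin.last k)

/-! ### Borel–Cantelli and almost sure convergence. -/

theorem expProduct_lt_apply {θ : ℕ → ℝ} (hθ : ∀ i, 0 < θ i) (x : ℝ≥0) (i : ℕ) :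
    expProduct θ {ω | (x : ℝ) < ω i} = ENNReal.ofReal (Real.exp (-θ i * x)) := by
  rw [← expMeasure_Ioi (hθ i) x.coe_nonneg, ← (measurePreserving_eval_expProduct hθ i).measure_preimage
    measurableSet_Ioi.nullMeasurableSet]
  rfl

theorem expProduct_ae_frequently_lt {θ : ℕ → ℝ} (hθ : ∀ i, 0 < θ i) {x : ℝ≥0}
    (hx : expSum θ x = ∞) : ∀ᵐ ω ∂expProduct θ, ∃ᶠ i in atTop, (x : ℝ) < ω i := by
  have := fun i => isProbabilityMeasure_expMeasure (hθ i)
  have := isProbabilityMeasure_expProduct hθ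
  have hm : ∀ i, MeasurableSet {ω : ℕ → ℝ | (x : ℝ) < ω i} := fun i =>
    measurableSet_lt (by fun_prop) (by fun_prop)
  have hind : iIndepSet (fun i => {ω : ℕ → ℝ | (x : ℝ) < ω i}) (expProduct θ) := by
    rw [iIndepSet_iff_meas_biInter hm]
    intro s
    have : ⋂ i ∈ s, {ω : ℕ → ℝ | (x : ℝ) < ω i} = Set.pi s fun _ => Set.Ioi (x : ℝ) := by
      ext; simp
    rw [this, expProduct, Measure.infinitePi_pi _ fun _ _ => measurableSet_Ioi]
    refine Finset.prod_congr rfl fun i _ => ?_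
    rw [expMeasure_Ioi (hθ i) x.coe_nonneg, ← expProduct_lt_apply hθ x i, expProduct]
  have h := measure_limsup_eq_one hm hind (by simp_rw [expProduct_lt_apply hθ]; exact hx)
  have h' : limsup (fun i => {ω : ℕ → ℝ | (x : ℝ) < ω i}) atTop ∈ ae (expProduct θ) :=
    (mem_ae_iff_prob_eq_one (.measurableSet_limsup hm)).2 h
  filter_upwards [h'] with ω hω
  exact mem_limsup_iff_frequently_mem.1 hω

theorem expProduct_ae_eventually_le {θ : ℕ → ℝ} (hθ : ∀ i, 0 < θ i) {x : ℝ≥0}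
    (hx : expSum θ x < ∞) : ∀ᵐ ω ∂expProduct θ, ∀ᶠ i in atTop, ω i ≤ (x : ℝ) := by
  have h := measure_limsup_atTop_eq_zero (μ := expProduct θ)
    (s := fun i => {ω : ℕ → ℝ | (x : ℝ) < ω i})
    (by simp_rw [expProduct_lt_apply hθ]; exact hx.ne)
  filter_upwards [measure_eq_zero_iff_ae_notMem.1 h] with ω hω
  rw [mem_limsup_iff_frequently_mem, not_frequently] at hω
  exact hω.mono fun i hi => not_lt.1 hi

theorem expSum_antitone {θ : ℕ → ℝ} (hθ : ∀ i, 0 < θ i) : Antitone (expSum θ) := by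
  intro x y hxy
  refine ENNReal.tsum_le_tsum fun i => ENNReal.ofReal_le_ofReal (Real.exp_le_exp.2 ?_)
  have : (x : ℝ) ≤ y := hxy
  nlinarith [hθ i]

theorem expSum_zero (θ : ℕ → ℝ) : expSum θ 0 = ∞ := by
  simp [expSum]

theorem expSum_eq_top_of_lt_critPoint {θ : ℕ → ℝ} {x : ℝ≥0} (hx : x < critPoint θ) :
    expSum θ x = ∞ := by
  by_contra h
  exact absurd (sInf_le ⟨x, lt_top_iff_ne_top.2 h, rfl⟩ : critPoint θ ≤ x) (not_le.2 hx)

theorem expSum_lt_top_of_critPoint_lt {θ : ℕ → ℝ} (hθ : ∀ i, 0 < θ i) {x : ℝ≥0}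
    (hx : critPoint θ < x) : expSum θ x < ∞ := by
  obtain ⟨_, ⟨y, hy, rfl⟩, hyx⟩ := sInf_lt_iff.1 hx
  exact (expSum_antitone hθ (ENNReal.coe_lt_coe.1 hyx).le).trans_lt hy

theorem expProduct_ae_exists_tendsto {θ : ℕ → ℝ} (hθ : ∀ i, 0 < θ i) (hc : critPoint θ < ∞)
    (hf : expSum θ (critPoint θ).toNNReal = ∞) :
    ∀ᵐ ω ∂expProduct θ, ∃ s, Tendsto (fun n => sortedIndices n ω) atTop (𝓝 s) := by
  set c := (critPoint θ).toNNReal with hcdef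
  have hcc : critPoint θ = c := (ENNReal.coe_toNNReal hc.ne).symm
  -- Countably many levels decreasing to `x₀` keep the exceptional set null.
  have h1 : ∀ m : ℕ, ∀ᵐ ω ∂expProduct θ, ∀ᶠ i in atTop, ω i ≤ ((c + 1 / (m + 1) : ℝ≥0) : ℝ) := by
    intro m
    refine expProduct_ae_eventually_le hθ (expSum_lt_top_of_critPoint_lt hθ ?_)
    rw [hcc, ENNReal.coe_lt_coe]
    exact lt_add_of_pos_right _ (by positivity)
  filter_upwards [expProduct_ae_injective hθ, expProduct_ae_frequently_lt hθ hf,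
    ae_all_iff.2 h1] with ω hi hfr hev
  refine exists_tendsto_sortedIndices hi hfr fun y hy => ?_
  obtain ⟨m, hm⟩ := exists_nat_one_div_lt (sub_pos.2 hy)
  filter_upwards [hev m] with i hi
  push_cast at hi
  linarith

theorem exists_tendsto_map_of_ae_tendsto {Ω E : Type*} [MeasurableSpace Ω] {P : Measure Ω}
    [IsProbabilityMeasure P] [TopologicalSpace E] [PolishSpace E] [MeasurableSpace E]
    [BorelSpace E] {X : ℕ → Ω → E} (hX : ∀ n, Measurable (X n))
    (h : ∀ᵐ ω ∂P, ∃ s, Tendsto (fun n => X n ω) atTop (𝓝 s)) {ν : ℕ → ProbabilityMeasure E}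
    (hν : ∀ n, (ν n : Measure E) = P.map (X n)) :
    ∃ μ : ProbabilityMeasure E, Tendsto ν atTop (𝓝 μ) := by
  -- A compatible metric gives access to a measurable version of the almost sure limit.
  let _ := TopologicalSpace.upgradeIsCompletelyMetrizable E
  obtain ⟨Y, hY, hlim⟩ := measurable_limit_of_tendsto_metrizable_ae
    (fun n => (hX n).aemeasurable) h
  have hp : IsProbabilityMeasure (P.map Y) := Measure.isProbabilityMeasure_map hY.aemeasurable
  refine ⟨(⟨P.map Y, hp⟩ : ProbabilityMeasure E),
    ProbabilityMeasure.tendsto_iff_forall_integral_tendsto.2 fun f => ?_⟩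
  have hfm : Measurable f := f.continuous.measurable
  simp_rw [hν]
  change Tendsto _ _ (𝓝 (∫ x, f x ∂P.map Y))
  simp_rw [fun n => integral_map (hX n).aemeasurable (hfm.aestronglyMeasurable (μ := P.map (X n)))]
  rw [integral_map hY.aemeasurable hfm.aestronglyMeasurable]
  refine tendsto_integral_of_dominated_convergence (fun _ => ‖f‖)
    (fun n => (hfm.comp (hX n)).aestronglyMeasurable) (integrable_const _)
    (fun n => .of_forall fun ω => f.norm_coe_le_norm _) ?_
  filter_upwards [hlim] with ω hω
  exact (f.continuous.tendsto _).comp hω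

theorem exists_tendsto_reverseLuceLaw {θ : ℕ → ℝ} (hθ : ∀ i, 0 < θ i) (hc : critPoint θ < ∞)
    (hf : expSum θ (critPoint θ).toNNReal = ∞) :
    ∃ μ : ProbabilityMeasure (ℕ → ℕ), Tendsto (reverseLuceLaw θ hθ) atTop (𝓝 μ) := by
  have := isProbabilityMeasure_expProduct hθ
  exact exists_tendsto_map_of_ae_tendsto measurable_sortedIndices
    (expProduct_ae_exists_tendsto hθ hc hf) (reverseLuceLaw_eq_map hθ)

/-! ### Necessity: escape of mass. -/

/-- If on an event of positive probability the supremum of the exponential variables is not attained,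
then the laws of the sorted indices do not converge. -/
theorem not_tendsto_reverseLuceLaw {θ : ℕ → ℝ} (hθ : ∀ i, 0 < θ i) {B : Set (ℕ → ℝ)}
    (hB : MeasurableSet B) (hB0 : expProduct θ B ≠ 0)
    (hmax : ∀ᵐ ω ∂expProduct θ, ω ∈ B → ∀ j, ∃ i, ω j < ω i) (μ : ProbabilityMeasure (ℕ → ℕ)) :
    ¬ Tendsto (reverseLuceLaw θ hθ) atTop (𝓝 μ) := by
  intro hlim
  have := isProbabilityMeasure_expProduct hθ
  have hev : Measurable fun s : ℕ → ℕ => s 0 := by fun_prop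
  have hzero : ∀ N : ℕ, Tendsto (fun n => expProduct θ {ω | ω ∈ B ∧ sortedIndices n ω 0 < N})
      atTop (𝓝 0) := by
    intro N
    have hm : ∀ n, MeasurableSet {ω | ω ∈ B ∧ sortedIndices n ω 0 < N} := fun n =>
      hB.inter ((hev.comp (measurable_sortedIndices n)) (measurableSet_Iio (a := N)))
    have h := tendsto_measure_of_ae_tendsto_indicator (μ := expProduct θ)
      (As := fun n => {ω | ω ∈ B ∧ sortedIndices n ω 0 < N}) (A := ∅) atTop MeasurableSet.empty hm
      (B := Set.univ) MeasurableSet.univ (measure_ne_top _ _) (.of_forall fun _ => Set.subset_univ _)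
      ?_
    · simpa using h
    · filter_upwards [hmax, expProduct_ae_injective hθ] with ω h1 h2
      by_cases hωB : ω ∈ B
      -- Each index `j < N` is beaten by `i j`; once `n` exceeds all these finitely many `i j`, the
      -- maximum sits at an index at least `N`.
      · choose i hi using h1 hωB
        have hN : ∀ᶠ n in atTop, ∀ j : Fin N, i j < n :=
          eventually_all.2 fun j => eventually_gt_atTop _
        filter_upwards [hN] with n hn
        simp only [Set.mem_empty_iff_false, iff_false, not_and]
        intro _ hlt
        exact absurd (apply_sortedIndices_zero_ge h2 (hn ⟨_, hlt⟩)) (not_le.2 (hi _))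
      · exact .of_forall fun n => by simp [hωB]
  have hbound : ∀ N : ℕ, (μ : Measure (ℕ → ℕ)) {s | s 0 < N} ≤ expProduct θ Bᶜ := by
    intro N
    have hclopen : IsClopen {s : ℕ → ℕ | s 0 < N} :=
      (isClopen_discrete (Set.Iio N)).preimage (continuous_apply 0)
    have h1 : Tendsto (fun n => (reverseLuceLaw θ hθ n : Measure (ℕ → ℕ)) {s | s 0 < N}) atTop
        (𝓝 ((μ : Measure (ℕ → ℕ)) {s | s 0 < N})) :=
      ProbabilityMeasure.tendsto_measure_of_null_frontier_of_tendsto' hlim (by simp [hclopen.frontier_eq])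
    have h2 := (hzero N).const_add (expProduct θ Bᶜ)
    rw [add_zero] at h2
    refine le_of_tendsto_of_tendsto' h1 h2 fun n => ?_
    rw [reverseLuceLaw_eq_map, Measure.map_apply (measurable_sortedIndices n) hclopen.isOpen.measurableSet]
    refine (measure_mono fun ω hω => ?_).trans (measure_union_le _ _)
    by_cases h : ω ∈ B
    · exact Or.inr ⟨h, hω⟩
    · exact Or.inl h
  have huniv : (μ : Measure (ℕ → ℕ)) Set.univ ≤ expProduct θ Bᶜ := by
    have hU : (⋃ N : ℕ, {s : ℕ → ℕ | s 0 < N}) = Set.univ :=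
      Set.eq_univ_of_forall fun s => Set.mem_iUnion.2 ⟨s 0 + 1, Nat.lt_succ_self _⟩
    rw [← hU]
    refine le_of_tendsto' (tendsto_measure_iUnion_atTop fun N M hNM s (hs : s 0 < N) =>
      hs.trans_le hNM) hbound
  rw [measure_univ, prob_compl_eq_one_sub hB] at huniv
  exact absurd huniv (not_le.2 (ENNReal.sub_lt_self ENNReal.one_ne_top one_ne_zero hB0))

/-- Almost surely `ω i ≤ c` from some index on, so for some fixed `m` the bound holds from `m` on
with positive probability. The first `m` coordinates then contribute finitely many positive factors.
-/
theorem expProduct_forall_le_ne_zero {θ : ℕ → ℝ} (hθ : ∀ i, 0 < θ i) {c : ℝ≥0} (hc : 0 < c)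
    (hf : expSum θ c < ∞) : expProduct θ (Set.univ.pi fun _ => Set.Iic (c : ℝ)) ≠ 0 := by
  have hp := fun i => isProbabilityMeasure_expMeasure (hθ i)
  have hP := isProbabilityMeasure_expProduct hθ
  obtain ⟨m, hm⟩ : ∃ m : ℕ, expProduct θ ((Set.Ici m).pi fun _ => Set.Iic (c : ℝ)) ≠ 0 := by
    by_contra! h
    have h1 := measure_iUnion_null h
    have h2 : ∀ᵐ ω ∂expProduct θ, False := by
      filter_upwards [measure_eq_zero_iff_ae_notMem.1 h1, expProduct_ae_eventually_le hθ hf]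
        with ω h3 h4
      obtain ⟨m, hm⟩ := eventually_atTop.1 h4
      exact h3 (Set.mem_iUnion.2 ⟨m, fun i hi => hm i hi⟩)
    exact hP.ne_zero _ (by simpa using h2)
  -- The infinite product is an infimum over finite sets `s`, so it suffices to bound each product
  -- over `s`, split at `m`.
  have hle : (∏ i ∈ Finset.range m, expMeasure (θ i) (Set.Iic (c : ℝ))) *
      expProduct θ ((Set.Ici m).pi fun _ => Set.Iic (c : ℝ)) ≤
      expProduct θ (Set.univ.pi fun _ => Set.Iic (c : ℝ)) := by
    conv_rhs => rw [expProduct, Measure.infinitePi_pi_univ _ fun _ => measurableSet_Iic,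
      ENNReal.tprod_eq_iInf_prod fun _ => prob_le_one]
    refine le_iInf fun s => ?_
    rw [← Finset.prod_filter_mul_prod_filter_not s (· < m)]
    refine mul_le_mul' ?_ ?_
    · exact Finset.prod_le_prod_of_subset_of_le_one'
        (fun i hi => Finset.mem_range.2 (Finset.mem_filter.1 hi).2) fun _ _ _ => prob_le_one
    · rw [← Measure.infinitePi_pi _ fun _ _ => measurableSet_Iic]
      refine measure_mono fun ω hω i hi => hω i ?_
      exact not_lt.1 (Finset.mem_filter.1 hi).2
  refine (lt_of_lt_of_le (pos_iff_ne_zero.2 (mul_ne_zero ?_ hm)) hle).ne'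
  refine Finset.prod_ne_zero_iff.2 fun i _ => ?_
  rw [expMeasure_Iic (hθ i) c.coe_nonneg]
  refine (ENNReal.ofReal_pos.2 (sub_pos.2 (Real.exp_lt_one_iff.2 ?_))).ne'
  have : (0 : ℝ) < c := hc
  nlinarith [hθ i]

theorem critPoint_of_tendsto {θ : ℕ → ℝ} (hθ : ∀ i, 0 < θ i) {μ : ProbabilityMeasure (ℕ → ℕ)}
    (hμ : Tendsto (reverseLuceLaw θ hθ) atTop (𝓝 μ)) :
    critPoint θ < ∞ ∧ expSum θ (critPoint θ).toNNReal = ∞ := by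
  have hP := isProbabilityMeasure_expProduct hθ
  have hct : critPoint θ < ∞ := by
    by_contra h
    have htop : critPoint θ = ∞ := not_lt_top_iff.1 h
    refine not_tendsto_reverseLuceLaw hθ MeasurableSet.univ (by simp) ?_ μ hμ
    have h1 : ∀ m : ℕ, ∀ᵐ ω ∂expProduct θ, ∃ᶠ i in atTop, ((m : ℝ≥0) : ℝ) < ω i := fun m =>
      expProduct_ae_frequently_lt hθ (expSum_eq_top_of_lt_critPoint (by simp [htop]))
    filter_upwards [ae_all_iff.2 h1] with ω hω _ j
    obtain ⟨m, hm⟩ := exists_nat_gt (ω j)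
    obtain ⟨i, hi⟩ := (hω m).exists
    exact ⟨i, hm.trans (by simpa using hi)⟩
  refine ⟨hct, ?_⟩
  set c := (critPoint θ).toNNReal with hcdef
  have hcc : critPoint θ = c := (ENNReal.coe_toNNReal hct.ne).symm
  by_contra hne
  have hlt : expSum θ c < ∞ := lt_top_iff_ne_top.2 hne
  -- `f(0) = ∞` excludes `x₀ = 0`; positivity also lets negative rationals be truncated to `0`
  -- below.
  have hc0 : 0 < c := by
    refine pos_iff_ne_zero.2 fun h0 => hne ?_
    rw [h0, expSum_zero]
  refine not_tendsto_reverseLuceLaw hθ (.univ_pi fun _ => measurableSet_Iic)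
    (expProduct_forall_le_ne_zero hθ hc0 hlt) ?_ μ hμ
  have h1 : ∀ q : ℚ, ∀ᵐ ω ∂expProduct θ, (q : ℝ) < c →
      ∃ᶠ i in atTop, (Real.toNNReal q : ℝ) < ω i := by
    intro q
    by_cases hq : (q : ℝ) < c
    · filter_upwards [expProduct_ae_frequently_lt hθ (x := Real.toNNReal q)
        (expSum_eq_top_of_lt_critPoint (by
          rw [hcc, ENNReal.coe_lt_coe]
          exact (Real.toNNReal_lt_toNNReal_iff (NNReal.coe_pos.2 hc0)).2 hq |>.trans_eq Real.toNNReal_coe))] with ω hω _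
      exact hω
    · exact .of_forall fun _ h => absurd h hq
  -- Almost surely no value equals `c`, so `ω j ≤ c` becomes strict and a rational level fits in
  -- between, which infinitely many values exceed.
  filter_upwards [ae_all_iff.2 h1, expProduct_ae_ne hθ c] with ω hω hne hB j
  have hj : ω j < c := lt_of_le_of_ne (hB j trivial) (hne j)
  obtain ⟨q, hq1, hq2⟩ := exists_rat_btwn hj
  obtain ⟨i, hi⟩ := (hω q hq2).exists
  exact ⟨i, hq1.trans ((Real.le_coe_toNNReal _).trans_lt hi)⟩

/-! ### The limiting mass functions. -/

theorem lintegral_pi_prod : ∀ {n : ℕ} (g : Fin n → ℝ → ℝ≥0∞), (∀ i, Measurable (g i)) →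
    ∫⁻ x : Fin n → ℝ, ∏ i, g i (x i) = ∏ i, ∫⁻ t, g i t
  | 0, g, _ => by simp [volume_pi]
  | n + 1, g, hg => by
    have hmp := (volume_preserving_piFinSuccAbove (fun _ : Fin (n + 1) => ℝ) 0).symm
    rw [← hmp.lintegral_comp (by fun_prop), Measure.volume_eq_prod, Fin.prod_univ_succ,
      ← lintegral_pi_prod (fun i => g i.succ) fun i => hg _,
      ← lintegral_prod_mul (hg 0).aemeasurable
        (Finset.measurable_fun_prod _ fun i _ => (hg i.succ).comp (measurable_pi_apply i)).aemeasurable]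
    refine lintegral_congr fun p => ?_
    rw [Fin.prod_univ_succ]
    simp [MeasurableEquiv.piFinSuccAbove, Fin.insertNthEquiv]

theorem pi_withDensity {n : ℕ} (g : Fin n → ℝ → ℝ≥0∞) (hg : ∀ i, Measurable (g i))
    [∀ i, SigmaFinite (volume.withDensity (g i))] :
    Measure.pi (fun i => volume.withDensity (g i)) =
      (volume : Measure (Fin n → ℝ)).withDensity fun x => ∏ i, g i (x i) := by
  refine Measure.pi_eq fun s hs => ?_
  rw [withDensity_apply _ (.univ_pi hs), ← lintegral_indicator (.univ_pi hs)]
  have : ∀ x : Fin n → ℝ, (Set.univ.pi s).indicator (fun x => ∏ i, g i (x i)) x =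
      ∏ i, (s i).indicator (g i) (x i) := by
    intro x
    by_cases hx : x ∈ Set.univ.pi s
    · rw [Set.indicator_of_mem hx]
      exact Finset.prod_congr rfl fun i _ => (Set.indicator_of_mem (hx i trivial) _).symm
    · rw [Set.indicator_of_notMem hx]
      simp only [Set.mem_univ_pi, not_forall] at hx
      obtain ⟨i, hi⟩ := hx
      exact (Finset.prod_eq_zero (Finset.mem_univ i) (Set.indicator_of_notMem hi _)).symm
  simp_rw [this]
  rw [lintegral_pi_prod _ fun i => (hg i).indicator (hs i)]
  refine Finset.prod_congr rfl fun i _ => ?_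
  rw [lintegral_indicator (hs i), withDensity_apply _ (hs i)]

/-- In `ℝ≥0∞` the product always converges, to a value at most `1`, and `toReal` is continuous
there. A product equal to `0` is included. -/
theorem tprod_toReal {ι : Type*} {p : ι → ℝ≥0∞} (hp : ∀ i, p i ≤ 1) :
    ∏' i, (p i).toReal = (∏' i, p i).toReal := by
  have h := (ENNReal.multipliable_of_le_one hp).hasProd
  have hne : ∏' i, p i ≠ ∞ := by
    rw [ENNReal.tprod_eq_iInf_prod hp]
    exact ((iInf_le _ ∅).trans_lt (by simp)).ne
  have h2 : HasProd (fun i => (p i).toReal) (∏' i, p i).toReal := by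
    have h3 := (ENNReal.tendsto_toReal hne).comp h
    refine h3.congr fun s => ?_
    simp [ENNReal.toReal_prod]
  exact h2.tprod_eq

/-- Independence from the infinite family of remaining coordinates reduces to finite subfamilies,
whose index sets are disjoint from the range of `a`. -/
theorem indepFun_expProduct_comp {θ : ℕ → ℝ} (hθ : ∀ i, 0 < θ i) {k : ℕ}
    (a : Fin (k + 1) → ℕ) :
    IndepFun (fun (ω : ℕ → ℝ) j => ω (a j))
      (fun (ω : ℕ → ℝ) (i : {i : ℕ // i ∉ Set.range a}) => ω i) (expProduct θ) := by
  have hp := fun i => isProbabilityMeasure_expMeasure (hθ i)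
  have hP := isProbabilityMeasure_expProduct hθ
  have hind : iIndepFun (fun (i : ℕ) (ω : ℕ → ℝ) => ω i) (expProduct θ) :=
    iIndepFun_infinitePi (X := fun _ x => x) fun _ => measurable_id
  refine IndepFun.indepFun_process (by fun_prop) (fun i => by fun_prop) fun J => ?_
  have hd : Disjoint (Finset.univ.image a) (J.map ⟨Subtype.val, Subtype.val_injective⟩) := by
    rw [Finset.disjoint_left]
    intro i hi hiJ
    simp only [Finset.mem_image, Finset.mem_univ, true_and] at hi
    obtain ⟨l, -, rfl⟩ := Finset.mem_map.1 hiJ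
    exact l.2 hi
  have h := hind.indepFun_finset _ _ hd fun i => measurable_pi_apply i
  exact h.comp
    (φ := fun z j => z ⟨a j, Finset.mem_image_of_mem a (Finset.mem_univ j)⟩)
    (ψ := fun z (i : J) => z ⟨i, Finset.mem_map_of_mem _ i.2⟩)
    (measurable_pi_lambda _ fun j => measurable_pi_apply _)
    (measurable_pi_lambda _ fun j => measurable_pi_apply _)

theorem measurableSet_strictAnti {k : ℕ} : MeasurableSet {x : Fin (k + 1) → ℝ | StrictAnti x} := by
  have : {x : Fin (k + 1) → ℝ | StrictAnti x} =
      ⋂ i, ⋂ j, ⋂ (_ : i < j), {x : Fin (k + 1) → ℝ | x j < x i} := by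
    ext x; simp [StrictAnti]
  rw [this]
  exact .iInter fun i => .iInter fun j => .iInter fun _ =>
    measurableSet_lt (by fun_prop) (by fun_prop)

theorem measurableSet_decreasingRegion (k : ℕ) : MeasurableSet (decreasingRegion k) :=
  measurableSet_strictAnti.inter (measurableSet_lt measurable_const (measurable_pi_apply _))

theorem measurableSet_topEvent {k : ℕ} (a : Fin (k + 1) → ℕ) (n : ℕ) :
    MeasurableSet (topEvent a n) := by
  have h1 : MeasurableSet {ω : ℕ → ℝ | StrictAnti (ω ∘ a)} :=
    (show Measurable fun (ω : ℕ → ℝ) => ω ∘ a by unfold Function.comp; fun_prop)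
      measurableSet_strictAnti
  have h2 : MeasurableSet {ω : ℕ → ℝ | ∀ i < n, i ∉ Set.range a → ω i < ω (a (Fin.last k))} := by
    have : {ω : ℕ → ℝ | ∀ i < n, i ∉ Set.range a → ω i < ω (a (Fin.last k))} =
        ⋂ i, ⋂ (_ : i < n), ⋂ (_ : i ∉ Set.range a), {ω : ℕ → ℝ | ω i < ω (a (Fin.last k))} := by
      ext; simp
    rw [this]
    exact .iInter fun i => .iInter fun _ => .iInter fun _ =>
      measurableSet_lt (by fun_prop) (by fun_prop)
  exact h1.inter h2

/-- The probability that all variables with index outside `Set.range a` are below `t`. -/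
def restBelow (θ : ℕ → ℝ) {k : ℕ} (a : Fin (k + 1) → ℕ) (t : ℝ) : ℝ≥0∞ :=
  Measure.infinitePi (fun i : {i : ℕ // i ∉ Set.range a} => expMeasure (θ i))
    (Set.univ.pi fun _ => Set.Iio t)

theorem measurable_restBelow {θ : ℕ → ℝ} (hθ : ∀ i, 0 < θ i) {k : ℕ} (a : Fin (k + 1) → ℕ) :
    Measurable (restBelow θ a) := by
  have hp := fun i : {i : ℕ // i ∉ Set.range a} => isProbabilityMeasure_expMeasure (hθ i)
  refine Monotone.measurable fun s t hst => measure_mono ?_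
  exact Set.pi_mono fun _ _ => Set.Iio_subset_Iio hst

theorem restBelow_toReal {θ : ℕ → ℝ} (hθ : ∀ i, 0 < θ i) {k : ℕ} (a : Fin (k + 1) → ℕ) {t : ℝ}
    (ht : 0 ≤ t) : (restBelow θ a t).toReal =
      ∏' i : {i : ℕ // i ∉ Set.range a}, (1 - Real.exp (-θ i * t)) := by
  have hp := fun i : {i : ℕ // i ∉ Set.range a} => isProbabilityMeasure_expMeasure (hθ i)
  rw [restBelow, Measure.infinitePi_pi_univ _ fun _ => measurableSet_Iio,
    ← tprod_toReal fun _ => prob_le_one]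
  congr 1 with i
  rw [expMeasure_Iio (hθ i) ht, ENNReal.toReal_ofReal]
  have : Real.exp (-θ i * t) ≤ 1 := Real.exp_le_one_iff.2 (by nlinarith [hθ i])
  linarith

theorem restBelow_ne_top {θ : ℕ → ℝ} (hθ : ∀ i, 0 < θ i) {k : ℕ} (a : Fin (k + 1) → ℕ) (t : ℝ) :
    restBelow θ a t ≠ ∞ := by
  have hp := fun i : {i : ℕ // i ∉ Set.range a} => isProbabilityMeasure_expMeasure (hθ i)
  exact measure_ne_top _ _

theorem limitIntegrand_eq {θ : ℕ → ℝ} (hθ : ∀ i, 0 < θ i) {k : ℕ} (a : Fin (k + 1) → ℕ)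
    {x : Fin (k + 1) → ℝ} (hx : x ∈ decreasingRegion k) :
    limitIntegrand θ a x =
      (∏ j, θ (a j) * Real.exp (-θ (a j) * x j)) * (restBelow θ a (x (Fin.last k))).toReal := by
  rw [restBelow_toReal hθ a hx.2.le, limitIntegrand]

theorem limitIntegrand_nonneg {θ : ℕ → ℝ} (hθ : ∀ i, 0 < θ i) {k : ℕ} (a : Fin (k + 1) → ℕ)
    {x : Fin (k + 1) → ℝ} (hx : x ∈ decreasingRegion k) : 0 ≤ limitIntegrand θ a x := by
  rw [limitIntegrand_eq hθ a hx]
  exact mul_nonneg (Finset.prod_nonneg fun j _ => mul_nonneg (hθ _).le (Real.exp_nonneg _))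
    ENNReal.toReal_nonneg

theorem aestronglyMeasurable_limitIntegrand {θ : ℕ → ℝ} (hθ : ∀ i, 0 < θ i) {k : ℕ}
    (a : Fin (k + 1) → ℕ) :
    AEStronglyMeasurable (limitIntegrand θ a) (volume.restrict (decreasingRegion k)) := by
  have h : Measurable fun x : Fin (k + 1) → ℝ =>
      (∏ j, θ (a j) * Real.exp (-θ (a j) * x j)) * (restBelow θ a (x (Fin.last k))).toReal :=
    Measurable.mul (by fun_prop)
      ((measurable_restBelow hθ a).comp (measurable_pi_apply _)).ennreal_toReal
  refine h.aestronglyMeasurable.congr ?_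
  filter_upwards [ae_restrict_mem (measurableSet_decreasingRegion k)] with x hx
  exact (limitIntegrand_eq hθ a hx).symm

theorem expProduct_iInter_topEvent {θ : ℕ → ℝ} (hθ : ∀ i, 0 < θ i) {k : ℕ} {a : Fin (k + 1) → ℕ}
    (ha : Function.Injective a) : expProduct θ (⋂ n, topEvent a n) =
      ∫⁻ x in decreasingRegion k, ENNReal.ofReal (limitIntegrand θ a x) := by
  have hp := fun i => isProbabilityMeasure_expMeasure (hθ i)
  have hP := isProbabilityMeasure_expProduct hθ
  let S : Set ((Fin (k + 1) → ℝ) × ({i : ℕ // i ∉ Set.range a} → ℝ)) :=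
    {p | p.1 ∈ decreasingRegion k ∧ ∀ i, p.2 i < p.1 (Fin.last k)}
  have hS : MeasurableSet S := by
    have h : S = Prod.fst ⁻¹' decreasingRegion k ∩ ⋂ i : {i : ℕ // i ∉ Set.range a},
        {p : (Fin (k + 1) → ℝ) × ({i : ℕ // i ∉ Set.range a} → ℝ) |
          p.2 i < p.1 (Fin.last k)} := by
      ext; simp [S]
    rw [h]
    refine (measurable_fst (measurableSet_decreasingRegion k)).inter ?_
    exact .iInter fun i => measurableSet_lt (by fun_prop) (by fun_prop)
  have hZ : Measurable fun (ω : ℕ → ℝ) j => ω (a j) := by fun_prop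
  have hW : Measurable fun (ω : ℕ → ℝ) (i : {i : ℕ // i ∉ Set.range a}) => ω i := by fun_prop
  -- The events agree only almost surely, since `decreasingRegion` also demands a positive last
  -- coordinate.
  have hae : (⋂ n, topEvent a n) =ᵐ[expProduct θ]
      (fun ω : ℕ → ℝ => ((fun j => ω (a j)), fun i : {i : ℕ // i ∉ Set.range a} => ω i)) ⁻¹' S := by
    rw [eventuallyEq_set]
    filter_upwards [expProduct_ae_pos hθ] with ω hω
    simp only [Set.mem_iInter]
    constructor
    · intro h
      exact ⟨⟨(h 0).1, hω _⟩, fun i => (h (i + 1)).2 i (Nat.lt_succ_self _) i.2⟩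
    · rintro ⟨⟨h1, -⟩, h2⟩ n
      exact ⟨h1, fun i _ hi => h2 ⟨i, hi⟩⟩
  have hmapW : (expProduct θ).map (fun (ω : ℕ → ℝ) (i : {i : ℕ // i ∉ Set.range a}) => ω i) =
      Measure.infinitePi fun i : {i : ℕ // i ∉ Set.range a} => expMeasure (θ i) :=
    Measure.map_infinitePi_infinitePi_of_inj Subtype.val_injective
  have hpw : ∀ j, SigmaFinite (volume.withDensity (exponentialPDF (θ (a j)))) := fun j => by
    rw [← expMeasure_eq_withDensity]; infer_instance
  rw [measure_congr hae, ← Measure.map_apply (hZ.prodMk hW) hS,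
    (indepFun_expProduct_comp hθ a).map_prod_eq_prod_map_map hZ.aemeasurable hW.aemeasurable,
    hmapW, expProduct_map_comp hθ ha, Measure.prod_apply hS]
  -- With the values at `a` fixed to `x`, what remains is that all other variables lie below the
  -- smallest of them.
  have hsec : ∀ x : Fin (k + 1) → ℝ,
      Measure.infinitePi (fun i : {i : ℕ // i ∉ Set.range a} => expMeasure (θ i))
        (Prod.mk x ⁻¹' S) =
      (decreasingRegion k).indicator (fun x => restBelow θ a (x (Fin.last k))) x := by
    intro x
    by_cases hx : x ∈ decreasingRegion k
    · rw [Set.indicator_of_mem hx, restBelow]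
      congr 1
      ext w
      simp [S, hx]
    · rw [Set.indicator_of_notMem hx]
      have : Prod.mk x ⁻¹' S = ∅ := by ext w; simp [S, hx]
      rw [this, measure_empty]
  have hpdf : Measurable fun x : Fin (k + 1) → ℝ => ∏ j, exponentialPDF (θ (a j)) (x j) :=
    Finset.measurable_fun_prod _ fun j _ =>
      (measurable_exponentialPDF _).comp (measurable_pi_apply j)
  have hrest : Measurable fun x : Fin (k + 1) → ℝ => restBelow θ a (x (Fin.last k)) :=
    (measurable_restBelow hθ a).comp (measurable_pi_apply _)
  simp_rw [hsec]
  rw [lintegral_indicator (measurableSet_decreasingRegion k)]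
  simp_rw [expMeasure_eq_withDensity]
  rw [pi_withDensity _ fun j => measurable_exponentialPDF _,
    setLIntegral_withDensity_eq_setLIntegral_mul _
      hpdf hrest
      (measurableSet_decreasingRegion k)]
  refine setLIntegral_congr_fun (measurableSet_decreasingRegion k) fun x hx => ?_
  have hx0 : ∀ j, 0 ≤ x j := fun j => hx.2.le.trans (hx.1.antitone (Fin.le_last j))
  have hnn : ∀ j, 0 ≤ θ (a j) * Real.exp (-θ (a j) * x j) := fun j =>
    mul_nonneg (hθ _).le (Real.exp_nonneg _)
  rw [limitIntegrand_eq hθ a hx, ENNReal.ofReal_mul (Finset.prod_nonneg fun j _ => hnn j),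
    ENNReal.ofReal_toReal (restBelow_ne_top hθ a _), ENNReal.ofReal_prod_of_nonneg fun j _ => hnn j,
    Pi.mul_apply]
  congr 1
  refine Finset.prod_congr rfl fun j _ => ?_
  rw [exponentialPDF_of_nonneg (hx0 j), neg_mul]

theorem integrableOn_limitIntegrand {θ : ℕ → ℝ} (hθ : ∀ i, 0 < θ i) {k : ℕ} {a : Fin (k + 1) → ℕ}
    (ha : Function.Injective a) : IntegrableOn (limitIntegrand θ a) (decreasingRegion k) := by
  have hP := isProbabilityMeasure_expProduct hθ
  refine ⟨aestronglyMeasurable_limitIntegrand hθ a, ?_⟩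
  rw [hasFiniteIntegral_iff_ofReal, ← expProduct_iInter_topEvent hθ ha]
  · exact measure_lt_top _ _
  · filter_upwards [ae_restrict_mem (measurableSet_decreasingRegion k)] with x hx
    exact limitIntegrand_nonneg hθ a hx

theorem integral_limitIntegrand {θ : ℕ → ℝ} (hθ : ∀ i, 0 < θ i) {k : ℕ} {a : Fin (k + 1) → ℕ}
    (ha : Function.Injective a) : ∫ x in decreasingRegion k, limitIntegrand θ a x =
      (expProduct θ).real (⋂ n, topEvent a n) := by
  rw [integral_eq_lintegral_of_nonneg_ae _ (aestronglyMeasurable_limitIntegrand hθ a),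
    ← expProduct_iInter_topEvent hθ ha]
  · rfl
  · filter_upwards [ae_restrict_mem (measurableSet_decreasingRegion k)] with x hx
    exact limitIntegrand_nonneg hθ a hx

theorem isClopen_cylinderAt {k : ℕ} (a : Fin (k + 1) → ℕ) : IsClopen (cylinderAt a) := by
  have : cylinderAt a = ⋂ j : Fin (k + 1), {s | s j = a j} := by ext; simp [cylinderAt]
  rw [this]
  exact isClopen_iInter_of_finite fun j =>
    (isClopen_discrete {a j}).preimage (continuous_apply (j : ℕ))

/-- Continuity from above along the decreasing `topEvent a n`; these match the cylinder events as
soon as `n` exceeds every `a j`. -/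
theorem tendsto_reverseLuceLaw_cylinderAt {θ : ℕ → ℝ} (hθ : ∀ i, 0 < θ i) {k : ℕ}
    {a : Fin (k + 1) → ℕ} (ha : Function.Injective a) :
    Tendsto (fun n => (reverseLuceLaw θ hθ n : Measure (ℕ → ℕ)).real (cylinderAt a)) atTop
      (𝓝 (∫ x in decreasingRegion k, limitIntegrand θ a x)) := by
  have hP := isProbabilityMeasure_expProduct hθ
  have h := tendsto_measure_iInter_atTop (μ := expProduct θ) (s := topEvent a)
    (fun n => (measurableSet_topEvent a n).nullMeasurableSet)
    (fun m n hmn ω hω => ⟨hω.1, fun i hi => hω.2 i (hi.trans_le hmn)⟩) ⟨0, measure_ne_top _ _⟩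
  rw [integral_limitIntegrand hθ ha]
  refine ((ENNReal.tendsto_toReal (measure_ne_top _ _)).comp h).congr' ?_
  have hN : ∀ᶠ n in atTop, ∀ j, a j < n :=
    eventually_all.2 fun j => eventually_gt_atTop (a j)
  filter_upwards [hN] with n hn
  simp only [Function.comp_apply, Measure.real]
  rw [reverseLuceLaw_eq_map, Measure.map_apply (measurable_sortedIndices n)
    (isClopen_cylinderAt a).isOpen.measurableSet]
  congr 1
  refine measure_congr (eventuallyEq_set.2 ?_)
  filter_upwards [expProduct_ae_injective hθ] with ω hω
  exact (sortedIndices_mem_cylinderAt_iff hω ha hn).symm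

end

theorem theorem4p2 (θ : ℕ → ℝ) (hpos : ∀ i, 0 < θ i) (hmono : Monotone θ) :
    ((∃ μ : ProbabilityMeasure (ℕ → ℕ), Tendsto (reverseLuceLaw θ hpos) atTop (𝓝 μ)) ↔
      critPoint θ < ∞ ∧ expSum θ (critPoint θ).toNNReal = ∞) ∧
    (critPoint θ < ∞ ∧ expSum θ (critPoint θ).toNNReal = ∞ →
      ∀ (k : ℕ) (a : Fin (k + 1) → ℕ), Function.Injective a →
        IntegrableOn (limitIntegrand θ a) (decreasingRegion k) ∧
        Tendsto (fun n => (reverseLuceLaw θ hpos n : Measure (ℕ → ℕ)).real (cylinderAt a)) atTop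
          (𝓝 (∫ x in decreasingRegion k, limitIntegrand θ a x)) ∧
        ∀ μ : ProbabilityMeasure (ℕ → ℕ), Tendsto (reverseLuceLaw θ hpos) atTop (𝓝 μ) →
          (μ : Measure (ℕ → ℕ)).real (cylinderAt a) =
            ∫ x in decreasingRegion k, limitIntegrand θ a x) := by
  refine ⟨⟨fun ⟨μ, hμ⟩ => critPoint_of_tendsto hpos hμ,
    fun h => exists_tendsto_reverseLuceLaw hpos h.1 h.2⟩, fun _ k a ha => ?_⟩
  have hlim := tendsto_reverseLuceLaw_cylinderAt hpos ha
  refine ⟨integrableOn_limitIntegrand hpos ha, hlim, fun μ hμ => ?_⟩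
  -- Cylinders are clopen, so weak convergence passes to their probabilities.
  have h1 := ProbabilityMeasure.tendsto_measure_of_null_frontier_of_tendsto' hμ
    (E := cylinderAt a) (by simp [(isClopen_cylinderAt a).frontier_eq])
  exact tendsto_nhds_unique ((ENNReal.tendsto_toReal (measure_ne_top _ _)).comp h1) hlim
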